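/- Let $\mathbf N$ denote the set of positive integers. For $S\subseteq\mathbf N$ and $n\in\mathbf N$, a positive integer $d$ is called an $S$-divisor of $n$ if $d\mid n$ and $\gcd(d,n/d)\in S$; let $\sigma_S(n)$ be the sum of the $S$-divisors of $n$. Call $S$ multiplicative if $1\in S$ and its characteristic function $\rho_S$ is multiplicative, i.e. $\rho_S(mn)=\rho_S(m)\rho_S(n)$ whenever $\gcd(m,n)=1$. Let $S\subseteq\mathbf N$ be multiplicative, and suppose that there is $s\in\mathbf N$ such that for every prime $p$ we have $p^j\in S$ for all $1\le j<s$, and $p^s\notin S$. Then $$\limsup_{n\to\infty}\frac{\sigma_S(n)}{n\log\log n}=\frac{e^{\gamma}}{\zeta(2s)},$$ where $\gamma$ is Euler's constant and $\zeta$ is the Riemann zeta function. In particular, the hypotheses hold for the set $Q_k=\{n\in\mathbf N: p^k\nmid n \text{ for every prime } p\mid n\}$ of $k$-free integers, with $s=k$, for every $k\ge 1$, so that the upper limit is $e^\gamma/\zeta(2k)$ for $S=Q_k$; and they hold for the set $L_k=\{n\in\mathbf N: p^k\mid n \text{ for every prime } p\mid n\}$ of $k$-full integers, with $s=1$, for every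 $k\ge 2$, so that the upper limit is $e^\gamma/\zeta(2)$ for $S=L_k$. -/

import Mathlib

namespace SConv

/-- The characteristic function `ρ_S` of a set `S`. Sets of positive integers are represented by
`S : Set ℕ`; whether `0 ∈ S` plays no role in any of the notions below. -/
noncomputable def rho (S : Set ℕ) : ℕ → ℕ :=
  S.indicator 1

/-- `S` is multiplicative: `1 ∈ S` and its characteristic function is multiplicative. -/
def IsMultiplicativeSet (S : Set ℕ) : Prop :=
  1 ∈ S ∧ ∀ m n : ℕ, 0 < m → 0 < n → Nat.Coprime m n → rho S (m * n) = rho S m * rho S n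

/-- `d` is an `S`-divisor of `n`: `d ∣ n` and `gcd(d, n/d) ∈ S`. -/
def IsSDivisor (S : Set ℕ) (d n : ℕ) : Prop :=
  d ∣ n ∧ Nat.gcd d (n / d) ∈ S

open Classical in
/-- `σ_S(n)`, the sum of the `S`-divisors of `n` (for `n ≥ 1`). -/
noncomputable def sigma (S : Set ℕ) (n : ℕ) : ℕ :=
  ∑ d ∈ n.divisors with IsSDivisor S d n, d

/-- For every prime `p`, the least exponent `j ≥ 1` with `p ^ j ∉ S` exists and equals `s`. -/
def HasUniformExponent (S : Set ℕ) (s : ℕ) : Prop :=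
  1 ≤ s ∧ ∀ p : ℕ, p.Prime → (∀ j : ℕ, 1 ≤ j → j < s → p ^ j ∈ S) ∧ p ^ s ∉ S

/-- The set `Q_k` of `k`-free positive integers. -/
def kFree (k : ℕ) : Set ℕ :=
  {n | 0 < n ∧ ∀ p : ℕ, p.Prime → p ∣ n → ¬ p ^ k ∣ n}

/-- The set `L_k` of `k`-full positive integers. -/
def kFull (k : ℕ) : Set ℕ :=
  {n | 0 < n ∧ ∀ p : ℕ, p.Prime → p ∣ n → p ^ k ∣ n}

/-- The upper limit of `σ_S(n) / (n log log n)` as `n → ∞`, in the extended reals, so that it is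
the genuine upper limit also for a sequence that is not known to be bounded. -/
noncomputable def limsupSigma (S : Set ℕ) : EReal :=
  Filter.limsup
    (fun n : ℕ => (((sigma S n : ℝ) / ((n : ℝ) * Real.log (Real.log (n : ℝ))) : ℝ) : EReal))
    Filter.atTop

/-- The real number `ζ(m)` for an integer `m ≥ 2`, as the real part of the complex value, which
is real (`ofReal_zetaNat`). -/
noncomputable def zetaNat (m : ℕ) : ℝ :=
  (riemannZeta (m : ℂ)).re

theorem ofReal_zetaNat (m : ℕ) (hm : 2 ≤ m) : ((zetaNat m : ℝ) : ℂ) = riemannZeta (m : ℂ) := by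
  have h : riemannZeta (m : ℂ) = ((∑' n : ℕ, 1 / (n : ℝ) ^ m : ℝ) : ℂ) := by
    rw [zeta_nat_eq_tsum_of_gt_one (by omega)]
    push_cast
    rfl
  rw [zetaNat, h, Complex.ofReal_re]

end SConv

/-! The ratio `σ_S(n) / n` is multiplicative, so the question is local. At `p ^ a` with `a < 2s` it
is at most the full divisor-sum ratio, hence at most `localFactor (2 * s) p = (1 - p^(-2s)) / (1 -
1/p)`. If `a ≥ 2s`, the divisor `p ^ (a - s)` is lost, since its gcd with `p ^ s` is `p ^ s ∉ S`,
and this loss of `p ^ (-s)` gives the same bound. Equality holds at `a = 2s - 1`, where every gcd is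
`p ^ j` with `j < s` (`sigmaRatio_prime_pow_le`, `sigmaRatio_prime_pow_eq`).

For the upper bound, primes up to `log n` contribute at most `localProd (2 * s) ⌊log n⌋₊`; there are
at most `log n / log log n` larger ones, and they contribute a factor tending to 1
(`sigmaRatio_le`). For the lower bound, `n = ∏_{p ≤ N} p ^ (2s - 1)` attains `localProd (2 * s) N`,
while Chebyshev's bound gives `log log n ≤ log N + O(1)`.

Both bounds need `localProd (2 * s) N ∼ (e^γ / ζ(2s)) log N`, which is the Euler product of `ζ(2s)`
times Mertens' third theorem. The latter is proved from the first two; its constant comes from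
comparing two expansions as `δ → 0+`: the prime sum `∑ p^(-1-δ)` is `-log δ + c - γ + o(1)`, with
`c` the constant of the second theorem, and `log ζ(1 + δ)` is `-log δ + o(1)`. -/

namespace Mertens

/-! ### Mertens' first theorem, from the prime factorization of `N!`. -/

open Finset Real Filter Topology

/-- The partial sum `∑_{p ≤ N} (log p) / p`. -/
noncomputable def logSum (N : ℕ) : ℝ := ∑ p ∈ Nat.primesLE N, log p / p

theorem log_factorial_eq_sum (N : ℕ) :
    log (N.factorial : ℝ) = ∑ p ∈ Nat.primesLE N, (N.factorial.factorization p : ℝ) * log p := by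
  rw [log_nat_eq_sum_factorization]
  refine Finsupp.sum_of_support_subset _ (fun p hp => ?_) _ (by simp)
  rw [Nat.support_factorization, Nat.mem_primeFactors] at hp
  exact Nat.mem_primesLE.2 ⟨(Nat.Prime.dvd_factorial hp.1).1 hp.2.1, hp.1⟩

theorem div_le_factorization_factorial {p : ℕ} (hp : p.Prime) (N : ℕ) :
    N / p ≤ N.factorial.factorization p := by
  rw [Nat.factorization_factorial hp (b := Nat.log p N + 2) (by omega)]
  have := Finset.single_le_sum (f := fun i => N / p ^ i) (s := Ico 1 (Nat.log p N + 2))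
    (fun _ _ => Nat.zero_le _) (a := 1) (by simp)
  simpa using this

theorem factorization_factorial_le {p : ℕ} (hp : p.Prime) (N : ℕ) :
    (N.factorial.factorization p : ℝ) ≤ N / (p - 1 : ℝ) := by
  have := Fact.mk hp
  have h1 : (p - 1) * N.factorial.factorization p ≤ N := by
    rw [Nat.factorization_def _ hp, sub_one_mul_padicValNat_factorial]
    omega
  have hp1 : (1 : ℝ) < p := by exact_mod_cast hp.one_lt
  rw [le_div_iff₀ (by linarith)]
  have h2 : (((p - 1) * N.factorial.factorization p : ℕ) : ℝ) ≤ N := by exact_mod_cast h1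
  rw [Nat.cast_mul, Nat.cast_sub hp.one_le] at h2
  push_cast at h2
  linarith

theorem sum_log_primesLE_le (N : ℕ) : ∑ p ∈ Nat.primesLE N, log (p : ℝ) ≤ log 4 * N := by
  rw [← Chebyshev.theta_eq_sum_primesLE_log]
  exact Chebyshev.theta_le_log4_mul_x (Nat.cast_nonneg N)

theorem log_factorial_le (N : ℕ) : log (N.factorial : ℝ) ≤ N * log N := by
  rw [← log_pow]
  refine log_le_log (by exact_mod_cast N.factorial_pos) ?_
  exact_mod_cast Nat.factorial_le_pow N

/-- Replacing `N / p` by the exponent of `p` in `N!` costs at most 1 per prime, in total at most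
`θ(N) ≤ N log 4`; then `N! ≤ N ^ N`. -/
theorem logSum_le {N : ℕ} (hN : 1 ≤ N) : logSum N ≤ log N + log 4 := by
  have hN' : (0 : ℝ) < N := by exact_mod_cast hN
  have h : (N : ℝ) * logSum N ≤ log (N.factorial : ℝ) + log 4 * N := by
    refine le_trans ?_ (add_le_add le_rfl (sum_log_primesLE_le N))
    rw [log_factorial_eq_sum, logSum, mul_sum, ← sum_add_distrib]
    refine sum_le_sum fun p hp => ?_
    have hp' := Nat.prime_of_mem_primesLE hp
    have h1 : (N : ℝ) / p ≤ N.factorial.factorization p + 1 := by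
      have h2 := Nat.lt_floor_add_one ((N : ℝ) / p)
      rw [Nat.floor_div_eq_div] at h2
      have h3 : ((N / p : ℕ) : ℝ) ≤ N.factorial.factorization p := by
        exact_mod_cast div_le_factorization_factorial hp' N
      linarith
    have h4 : 0 ≤ log (p : ℝ) := log_natCast_nonneg p
    calc (N : ℝ) * (log p / p) = (N / p) * log p := by ring
      _ ≤ (N.factorial.factorization p + 1) * log p := by gcongr
      _ = _ := by ring
  have h2 := log_factorial_le N
  have : (N : ℝ) * logSum N ≤ N * (log N + log 4) := by linarith
  exact le_of_mul_le_mul_left this hN'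

theorem summable_log_div_mul_sub_one :
    Summable fun n : ℕ => log (n : ℝ) / (n * (n - 1 : ℝ)) := by
  refine Summable.of_nonneg_of_le (f := fun n : ℕ => 4 * (n : ℝ) ^ (-(3 / 2) : ℝ)) ?_ ?_
    ((Real.summable_nat_rpow.2 (by norm_num)).mul_left 4)
  · intro n
    rcases n.eq_zero_or_pos with rfl | hn
    · simp
    · have : (1 : ℝ) ≤ n := by exact_mod_cast hn
      exact div_nonneg (log_natCast_nonneg n) (mul_nonneg (by linarith) (by linarith))
  · intro n
    rcases lt_or_ge n 2 with hn | hn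
    · interval_cases n
      · simp
      · simp
    · have h2 : (2 : ℝ) ≤ n := by exact_mod_cast hn
      have h0 : (0 : ℝ) < n := by linarith
      have h1 : log (n : ℝ) ≤ 2 * (n : ℝ) ^ (1 / 2 : ℝ) := by
        have := log_le_rpow_div h0.le (ε := 1 / 2) (by norm_num)
        linarith
      rw [div_le_iff₀ (mul_pos h0 (by linarith))]
      have h3 : (n : ℝ) ^ (-(3 / 2) : ℝ) * ((n : ℝ) * n) = (n : ℝ) ^ (1 / 2 : ℝ) := by
        rw [← sq, ← rpow_natCast, ← rpow_add h0]
        norm_num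
      have h4 : 0 ≤ (n : ℝ) ^ (-(3 / 2) : ℝ) := by positivity
      calc log (n : ℝ) ≤ 2 * ((n : ℝ) ^ (-(3 / 2) : ℝ) * ((n : ℝ) * n)) := by rw [h3]; exact h1
        _ = (n : ℝ) ^ (-(3 / 2) : ℝ) * n * (2 * n) := by ring
        _ ≤ (n : ℝ) ^ (-(3 / 2) : ℝ) * n * (4 * (n - 1)) :=
          mul_le_mul_of_nonneg_left (by linarith) (by positivity)
        _ = _ := by ring

/-- The exponent of `p` in `N!` is at most `N / (p - 1) = N / p + N / (p (p - 1))`. The second term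
contributes a convergent series, and Stirling bounds `log N!` below by `N log N - N`. -/
theorem exists_le_logSum : ∃ K : ℝ, ∀ N : ℕ, 1 ≤ N → log N - K ≤ logSum N := by
  refine ⟨1 + ∑' n : ℕ, log (n : ℝ) / (n * (n - 1 : ℝ)), fun N hN => ?_⟩
  have hN' : (0 : ℝ) < N := by exact_mod_cast hN
  have h1 : log (N.factorial : ℝ) ≤
      N * (logSum N + ∑ p ∈ Nat.primesLE N, log (p : ℝ) / (p * (p - 1 : ℝ))) := by
    rw [log_factorial_eq_sum, logSum, ← sum_add_distrib, mul_sum]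
    refine sum_le_sum fun p hp => ?_
    have hp' := Nat.prime_of_mem_primesLE hp
    have hp1 : (1 : ℝ) < p := by exact_mod_cast hp'.one_lt
    have hp2 : (p : ℝ) - 1 ≠ 0 := by linarith
    calc (N.factorial.factorization p : ℝ) * log p ≤ N / (p - 1 : ℝ) * log p :=
          mul_le_mul_of_nonneg_right (factorization_factorial_le hp' N) (log_natCast_nonneg p)
      _ = _ := by field_simp; ring
  have h2 : ∑ p ∈ Nat.primesLE N, log (p : ℝ) / (p * (p - 1 : ℝ)) ≤
      ∑' n : ℕ, log (n : ℝ) / (n * (n - 1 : ℝ)) := by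
    refine summable_log_div_mul_sub_one.sum_le_tsum _ fun n _ => ?_
    rcases n.eq_zero_or_pos with rfl | hn
    · simp
    · have : (1 : ℝ) ≤ n := by exact_mod_cast hn
      exact div_nonneg (log_natCast_nonneg n) (mul_nonneg (by linarith) (by linarith))
  have h3 : (N : ℝ) * log N - N ≤ log (N.factorial : ℝ) := by
    have := Stirling.le_log_factorial_stirling (n := N) (by omega)
    have h5 : 0 ≤ log (N : ℝ) := log_natCast_nonneg N
    have h6 : 0 ≤ log (2 * π) := log_nonneg (by nlinarith [pi_gt_three])
    linarith
  have h4 : (N : ℝ) * (log N - 1) ≤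
      N * (logSum N + ∑' n : ℕ, log (n : ℝ) / (n * (n - 1 : ℝ))) := by
    have := mul_le_mul_of_nonneg_left (add_le_add (le_refl (logSum N)) h2) hN'.le
    linarith
  have := le_of_mul_le_mul_left h4 hN'
  linarith

/-- Mertens' first theorem. -/
theorem exists_abs_logSum_sub_log_le :
    ∃ K : ℝ, 0 ≤ K ∧ ∀ N : ℕ, 1 ≤ N → |logSum N - log N| ≤ K := by
  obtain ⟨K, hK⟩ := exists_le_logSum
  refine ⟨max K (log 4), le_max_of_le_right (log_nonneg (by norm_num)), fun N hN => ?_⟩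
  rw [abs_le]
  have h1 := hK N hN
  have h2 := logSum_le hN
  have h3 := le_max_left K (log 4)
  have h4 := le_max_right K (log 4)
  constructor <;> linarith

end Mertens

/-! ### Mertens' second theorem, by partial summation. -/

namespace Mertens

open Finset Real Filter Topology

/-- The partial sum `∑_{p ≤ N} 1 / p`. -/
noncomputable def recipSum (N : ℕ) : ℝ := ∑ p ∈ Nat.primesLE N, (1 : ℝ) / p

theorem sum_primesLE_succ (f : ℕ → ℝ) (N : ℕ) :
    ∑ p ∈ Nat.primesLE (N + 1), f p =
      ∑ p ∈ Nat.primesLE N, f p + if (N + 1).Prime then f (N + 1) else 0 := by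
  rw [Nat.primesLE_succ]
  split_ifs with h
  · rw [sum_insert (Nat.notMem_primesLE N), add_comm]
  · rw [add_zero]

theorem log_add_two_pos (n : ℕ) : 0 < log ((n : ℝ) + 2) :=
  log_pos (by have : (0 : ℝ) ≤ n := n.cast_nonneg
              linarith)

/-- The difference between the coefficients of `logSum` and of `log`. -/
noncomputable def logCoeff (i : ℕ) : ℝ :=
  (if (i + 2).Prime then log ((i : ℝ) + 2) / ((i : ℝ) + 2) else 0) -
    (log ((i : ℝ) + 2) - log ((i : ℝ) + 1))

theorem sum_logCoeff (n : ℕ) :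
    ∑ i ∈ range n, logCoeff i = logSum (n + 1) - log ((n : ℝ) + 1) := by
  induction n with
  | zero => simp [logSum]
  | succ n ih =>
    rw [sum_range_succ, ih, logCoeff, logSum, logSum, sum_primesLE_succ _ (n + 1)]
    push_cast
    rw [show (n : ℝ) + 1 + 1 = n + 2 by ring]
    ring

/-- A Riemann sum for `log log`. -/
noncomputable def logLogSum (n : ℕ) : ℝ :=
  ∑ i ∈ range n, (log ((i : ℝ) + 2))⁻¹ * (log ((i : ℝ) + 2) - log ((i : ℝ) + 1))

theorem sum_inv_log_mul_logCoeff (n : ℕ) :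
    ∑ i ∈ range n, (log ((i : ℝ) + 2))⁻¹ • logCoeff i = recipSum (n + 1) - logLogSum n := by
  induction n with
  | zero => simp [recipSum, logLogSum]
  | succ n ih =>
    rw [sum_range_succ, ih, logCoeff, recipSum, recipSum, sum_primesLE_succ _ (n + 1), logLogSum,
      logLogSum, sum_range_succ, smul_eq_mul]
    have h := (log_add_two_pos n).ne'
    push_cast
    rw [show (n : ℝ) + 1 + 1 = n + 2 by ring, mul_sub, mul_ite, mul_zero]
    have h2 : (log ((n : ℝ) + 2))⁻¹ * (log ((n : ℝ) + 2) / ((n : ℝ) + 2)) = 1 / ((n : ℝ) + 2) := by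
      field_simp
    rw [h2]
    ring

theorem tendsto_log_natCast_add (c : ℝ) : Tendsto (fun n : ℕ => log ((n : ℝ) + c)) atTop atTop :=
  tendsto_log_atTop.comp (tendsto_atTop_add_const_right _ _ tendsto_natCast_atTop_atTop)

/-- Dirichlet's test: the partial sums of `logCoeff` are bounded by Mertens' first theorem, and the
weights `1 / log (n + 2)` decrease to 0. -/
theorem exists_tendsto_recipSum_sub_logLogSum :
    ∃ c : ℝ, Tendsto (fun n => recipSum (n + 1) - logLogSum n) atTop (𝓝 c) := by
  obtain ⟨K, -, hK⟩ := exists_abs_logSum_sub_log_le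
  have hanti : Antitone fun n : ℕ => (log ((n : ℝ) + 2))⁻¹ := by
    intro m n hmn
    refine inv_anti₀ (log_add_two_pos m) (log_le_log (by positivity) ?_)
    have : (m : ℝ) ≤ n := by exact_mod_cast hmn
    linarith
  have h := hanti.cauchySeq_series_mul_of_tendsto_zero_of_bounded (z := logCoeff) (b := K)
    (tendsto_log_natCast_add 2).inv_tendsto_atTop (fun n => by
      rw [sum_logCoeff, norm_eq_abs]
      have := hK (n + 1) (by omega)
      push_cast at this
      exact this)
  simp only [sum_inv_log_mul_logCoeff] at h
  exact cauchySeq_tendsto_of_complete h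

/-- Applying `1 - 1/t ≤ log t ≤ t - 1` to a quotient `t` of consecutive logarithms makes the error
of the Riemann sum decreasing, and increasing once `1 / log` is subtracted; the error therefore
converges. -/
theorem logLogSum_step (n : ℕ) :
    logLogSum (n + 2) - log (log ((n : ℝ) + 3)) ≤ logLogSum (n + 1) - log (log ((n : ℝ) + 2)) ∧
    logLogSum (n + 1) - log (log ((n : ℝ) + 2)) - (log ((n : ℝ) + 2))⁻¹ ≤
      logLogSum (n + 2) - log (log ((n : ℝ) + 3)) - (log ((n : ℝ) + 3))⁻¹ := by
  have ha := log_add_two_pos n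
  have hn : (0 : ℝ) ≤ n := n.cast_nonneg
  have hab : log ((n : ℝ) + 2) ≤ log ((n : ℝ) + 3) := log_le_log (by linarith) (by linarith)
  have hba : log ((n : ℝ) + 3) - log ((n : ℝ) + 2) ≤ 1 := by
    rw [← log_div (by positivity) (by positivity)]
    refine (log_le_sub_one_of_pos (by positivity)).trans ?_
    rw [sub_le_iff_le_add, div_le_iff₀ (by positivity)]
    linarith
  have hstep : logLogSum (n + 2) = logLogSum (n + 1) +
      (log ((n : ℝ) + 3))⁻¹ * (log ((n : ℝ) + 3) - log ((n : ℝ) + 2)) := by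
    rw [logLogSum, sum_range_succ, ← logLogSum]
    push_cast
    rw [show (n : ℝ) + 1 + 2 = n + 3 by ring, show (n : ℝ) + 1 + 1 = n + 2 by ring]
  rw [hstep]
  generalize log ((n : ℝ) + 2) = a at *
  generalize log ((n : ℝ) + 3) = b at *
  have hb : 0 < b := by linarith
  have h1 : 1 - (b / a)⁻¹ ≤ log (b / a) := one_sub_inv_le_log_of_pos (by positivity)
  have h2 : log (b / a) ≤ b / a - 1 := log_le_sub_one_of_pos (by positivity)
  rw [log_div hb.ne' ha.ne'] at h1 h2
  have h3 : b⁻¹ * (b - a) = 1 - (b / a)⁻¹ := by field_simp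
  have h4 : b / a - 1 = b⁻¹ * (b - a) + (b - a) * (a⁻¹ - b⁻¹) := by field_simp; ring
  have h5 : (b - a) * (a⁻¹ - b⁻¹) ≤ 1 * (a⁻¹ - b⁻¹) :=
    mul_le_mul_of_nonneg_right hba (sub_nonneg.2 (inv_anti₀ ha hab))
  constructor <;> linarith

theorem exists_tendsto_logLogSum_sub :
    ∃ c : ℝ, Tendsto (fun n : ℕ => logLogSum (n + 1) - log (log ((n : ℝ) + 2))) atTop (𝓝 c) := by
  have h1 : Antitone fun n : ℕ => logLogSum (n + 1) - log (log ((n : ℝ) + 2)) :=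
    antitone_nat_of_succ_le fun n => by
      have := (logLogSum_step n).1
      push_cast
      rwa [show (n : ℝ) + 1 + 2 = n + 3 by ring]
  have h2 : Monotone fun n : ℕ =>
      logLogSum (n + 1) - log (log ((n : ℝ) + 2)) - (log ((n : ℝ) + 2))⁻¹ :=
    monotone_nat_of_le_succ fun n => by
      have := (logLogSum_step n).2
      push_cast
      rwa [show (n : ℝ) + 1 + 2 = n + 3 by ring]
  have h3 : BddBelow (Set.range fun n : ℕ => logLogSum (n + 1) - log (log ((n : ℝ) + 2))) := by
    refine ⟨logLogSum (0 + 1) - log (log (((0 : ℕ) : ℝ) + 2)) - (log (((0 : ℕ) : ℝ) + 2))⁻¹, ?_⟩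
    rintro _ ⟨n, rfl⟩
    exact (h2 (Nat.zero_le n)).trans (sub_le_self _ (inv_pos.2 (log_add_two_pos n)).le)
  exact ⟨_, tendsto_atTop_ciInf h1 h3⟩

/-- Mertens' second theorem. -/
theorem exists_tendsto_recipSum_sub_log_log :
    ∃ c : ℝ, Tendsto (fun N : ℕ => recipSum N - log (log N)) atTop (𝓝 c) := by
  obtain ⟨c, hc⟩ := exists_tendsto_recipSum_sub_logLogSum
  obtain ⟨d, hd⟩ := exists_tendsto_logLogSum_sub
  refine ⟨c + d, (tendsto_add_atTop_iff_nat 2).1 ?_⟩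
  refine (((tendsto_add_atTop_iff_nat 1).2 hc).add hd).congr fun n => ?_
  push_cast
  ring_nf

theorem recipSum_mono : Monotone recipSum := fun _ _ h =>
  sum_le_sum_of_subset_of_nonneg (Nat.primesLE_mono h) fun _ _ _ => by positivity

theorem recipSum_nonneg (N : ℕ) : 0 ≤ recipSum N := sum_nonneg fun _ _ => by positivity

theorem tendsto_log_log_sub_log_log_floor :
    Tendsto (fun x : ℝ => log (log x) - log (log ⌊x⌋₊)) atTop (𝓝 0) := by
  have hf : Tendsto (fun x : ℝ => log (2 : ℝ) * (log (⌊x⌋₊ : ℝ))⁻¹) atTop (𝓝 0) := by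
    have := ((tendsto_log_atTop.comp tendsto_natCast_atTop_atTop).comp
      (tendsto_nat_floor_atTop (α := ℝ))).inv_tendsto_atTop.const_mul (log 2)
    simpa using this
  refine tendsto_of_tendsto_of_tendsto_of_le_of_le' tendsto_const_nhds hf ?_ ?_
  · filter_upwards [eventually_ge_atTop 2] with x hx
    have h2 : (2 : ℝ) ≤ ⌊x⌋₊ := by exact_mod_cast Nat.le_floor (by exact_mod_cast hx)
    have h3 := Nat.floor_le (show 0 ≤ x by linarith)
    exact sub_nonneg.2 (log_le_log (log_pos (by linarith)) (log_le_log (by linarith) h3))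
  · filter_upwards [eventually_ge_atTop 2] with x hx
    have h2 : (2 : ℝ) ≤ ⌊x⌋₊ := by exact_mod_cast Nat.le_floor (by exact_mod_cast hx)
    have h3 := Nat.floor_le (show 0 ≤ x by linarith)
    have h4 := Nat.lt_floor_add_one x
    have h5 : 0 < log (⌊x⌋₊ : ℝ) := log_pos (by linarith)
    have h6 : log x ≤ log 2 + log (⌊x⌋₊ : ℝ) := by
      rw [← log_mul (by norm_num) (by linarith)]
      exact log_le_log (by linarith) (by linarith)
    have h7 : 0 < log x := log_pos (by linarith)
    rw [← log_div h7.ne' h5.ne']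
    refine (log_le_sub_one_of_pos (by positivity)).trans ?_
    rw [sub_le_iff_le_add, div_le_iff₀ h5]
    field_simp
    linarith

theorem exists_tendsto_recipSum_floor_sub_log_log :
    ∃ c : ℝ, Tendsto (fun N : ℕ => recipSum N - log (log N)) atTop (𝓝 c) ∧
      Tendsto (fun x : ℝ => recipSum ⌊x⌋₊ - log (log x)) atTop (𝓝 c) := by
  obtain ⟨c, hc⟩ := exists_tendsto_recipSum_sub_log_log
  refine ⟨c, hc, ?_⟩
  have h := (hc.comp (tendsto_nat_floor_atTop (α := ℝ))).sub tendsto_log_log_sub_log_log_floor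
  rw [sub_zero] at h
  refine h.congr fun x => ?_
  simp only [Function.comp_apply]
  ring

end Mertens

/-! ### The prime sum `∑ p^(-1-δ)` as `δ → 0+`. -/

namespace Mertens

open Finset Real Filter Topology MeasureTheory

/-- This is `Γ'(1) = -γ`, by differentiating the Gamma integral under the integral sign. -/
theorem integral_log_mul_exp_neg :
    ∫ u in Set.Ioi (0 : ℝ), log u * exp (-u) = -eulerMascheroniConstant := by
  have h1 := Complex.hasDerivAt_GammaIntegral (s := 1) (by simp)
  have h2 : HasDerivAt Complex.Gamma (-eulerMascheroniConstant : ℂ) 1 :=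
    Complex.hasDerivAt_Gamma_one
  have h3 : Complex.GammaIntegral =ᶠ[𝓝 1] Complex.Gamma := by
    have : ∀ᶠ s : ℂ in 𝓝 1, 0 < s.re :=
      (Complex.continuous_re.continuousAt (x := 1)).eventually_const_lt (by simp)
    filter_upwards [this] with s hs using (Complex.Gamma_eq_integral hs).symm
  have h4 := h1.unique (h2.congr_of_eventuallyEq h3)
  rw [← Complex.ofReal_inj, ← integral_complex_ofReal]
  push_cast
  rw [← h4]
  refine setIntegral_congr_fun measurableSet_Ioi fun u _ => ?_
  simp

theorem integrableOn_log_mul_exp_neg :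
    IntegrableOn (fun u : ℝ => log u * exp (-u)) (Set.Ioi 0) := by
  -- A non-integrable function has integral 0 by convention, whereas this integral is `-γ ≠ 0`.
  refine Integrable.of_integral_ne_zero ?_
  rw [integral_log_mul_exp_neg]
  have := one_half_lt_eulerMascheroniConstant
  linarith

/-- Write `p^(-1-δ)` as `1/p` times the integral of `e^(-u)` over `u ≥ δ log p` and interchange; the
primes present at `u` are those with `p ≤ e^(u/δ)`. -/
theorem hasSum_primes_rpow {δ : ℝ} (hδ : 0 < δ) :
    HasSum (fun p : Nat.Primes => (p : ℝ) ^ (-(1 + δ)))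
      (∫ u in Set.Ioi (0 : ℝ), recipSum ⌊exp (u / δ)⌋₊ * exp (-u)) := by
  rw [Nat.Primes.hasSum_iff_hasSum_ite (f := fun n : ℕ => (n : ℝ) ^ (-(1 + δ)))]
  let F : ℕ → ℝ → ℝ := fun n u =>
    if n.Prime then (1 / n : ℝ) * (Set.Ici (δ * log n)).indicator (fun u => exp (-u)) u else 0
  have hF0 : ∀ n u, 0 ≤ F n u := fun n u => by
    simp only [F]
    split_ifs
    · exact mul_nonneg (by positivity) (Set.indicator_nonneg (fun _ _ => (exp_pos _).le) _)
    · exact le_rfl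
  have hFint : ∀ n, Integrable (F n) (volume.restrict (Set.Ioi 0)) := fun n => by
    simp only [F]
    split_ifs
    · exact ((integrableOn_exp_neg_Ioi 0).indicator measurableSet_Ici).const_mul _
    · exact integrable_zero _ _ _
  have hFval : ∀ n, ∫ u in Set.Ioi (0 : ℝ), F n u =
      if n.Prime then (n : ℝ) ^ (-(1 + δ)) else 0 := fun n => by
    simp only [F]
    split_ifs with hn
    · have hn0 : (1 : ℝ) < n := by exact_mod_cast hn.one_lt
      have hl : 0 < δ * log n := mul_pos hδ (log_pos hn0)
      rw [integral_const_mul, setIntegral_indicator measurableSet_Ici,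
        Set.inter_eq_self_of_subset_right (Set.Ici_subset_Ioi.2 hl), integral_Ici_eq_integral_Ioi,
        integral_exp_neg_Ioi, neg_add, rpow_add (by linarith), rpow_neg_one, one_div,
        rpow_def_of_pos (by linarith)]
      ring_nf
    · simp
  have hFsum : ∀ u, ∑' n, F n u = recipSum ⌊exp (u / δ)⌋₊ * exp (-u) := fun u => by
    have hiff : ∀ n : ℕ, n.Prime → (n ≤ ⌊exp (u / δ)⌋₊ ↔ δ * log n ≤ u) := fun n hn => by
      have hn0 : (0 : ℝ) < n := by exact_mod_cast hn.pos
      rw [Nat.le_floor_iff (exp_pos _).le, ← log_le_iff_le_exp hn0, le_div_iff₀ hδ, mul_comm]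
    rw [tsum_eq_sum (s := Nat.primesLE ⌊exp (u / δ)⌋₊), recipSum, sum_mul]
    · refine sum_congr rfl fun p hp => ?_
      have hp' := Nat.prime_of_mem_primesLE hp
      simp only [F]
      rw [if_pos hp', Set.indicator_of_mem]
      exact (hiff p hp').1 (Nat.le_of_mem_primesLE hp)
    · intro n hn
      simp only [F]
      split_ifs with h
      · rw [Set.indicator_of_notMem, mul_zero]
        intro h'
        exact hn (Nat.mem_primesLE.2 ⟨(hiff n h).2 h', h⟩)
      · rfl
  have hsum : Summable fun n : ℕ => if n.Prime then (n : ℝ) ^ (-(1 + δ)) else 0 := by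
    refine Summable.of_nonneg_of_le (fun n => ?_) (fun n => ?_)
      (Real.summable_nat_rpow.2 (show -(1 + δ) < -1 by linarith))
    · split_ifs <;> positivity
    · split_ifs
      · exact le_rfl
      · positivity
  have h := hasSum_integral_of_summable_integral_norm hFint (by
    simp only [norm_of_nonneg (hF0 _ _), hFval]
    exact hsum)
  simp only [hFval, hFsum] at h
  exact h

/-- Supplies a dominating function independent of `δ`. Where `u / δ` is large the error is at most
1; otherwise `u ≤ u / δ < V` controls `log (u / δ)`. -/
theorem exists_recipSum_error_bound {c : ℝ}
    (hc : Tendsto (fun x : ℝ => recipSum ⌊x⌋₊ - log (log x)) atTop (𝓝 c)) :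
    ∃ K : ℝ, ∀ δ u : ℝ, 0 < δ → δ < 1 → 0 < u →
      |recipSum ⌊exp (u / δ)⌋₊ - log (u / δ) - c| ≤ K + |log u| := by
  have h1 : ∀ᶠ x : ℝ in atTop, |recipSum ⌊x⌋₊ - log (log x) - c| ≤ 1 := by
    have := (hc.sub_const c).abs
    rw [sub_self, abs_zero] at this
    exact this.eventually_le_const one_pos
  obtain ⟨V, hV⟩ := ((tendsto_exp_atTop.eventually h1).and (eventually_ge_atTop 0)).exists_forall_of_atTop
  refine ⟨1 + recipSum ⌊exp V⌋₊ + |c| + |log V|, fun δ u hδ hδ1 hu => ?_⟩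
  have hr := recipSum_nonneg ⌊exp V⌋₊
  rcases le_or_gt V (u / δ) with h | h
  · have := (hV _ h).1
    rw [log_exp] at this
    have := abs_nonneg c
    have := abs_nonneg (log u)
    have := abs_nonneg (log V)
    linarith
  · have hu1 : u ≤ u / δ := by
      rw [le_div_iff₀ hδ]
      nlinarith
    have h2 : |log (u / δ)| ≤ |log u| + |log V| := by
      have h3 := log_le_log hu hu1
      have h4 := log_le_log (by linarith) h.le
      rw [abs_le]
      have := neg_abs_le (log u)
      have := le_abs_self (log V)
      have := abs_nonneg (log u)
      have := abs_nonneg (log V)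
      constructor <;> linarith
    have h5 : |recipSum ⌊exp (u / δ)⌋₊| ≤ recipSum ⌊exp V⌋₊ := by
      rw [abs_of_nonneg (recipSum_nonneg _)]
      exact recipSum_mono (Nat.floor_le_floor (exp_le_exp.2 h.le))
    have h6 := abs_sub (recipSum ⌊exp (u / δ)⌋₊ - log (u / δ)) c
    have h7 := abs_sub (recipSum ⌊exp (u / δ)⌋₊) (log (u / δ))
    linarith

/-- In the integral, `recipSum` is `log u - log δ + c` plus an error that vanishes by dominated
convergence; the `log u` term integrates to `-γ`. -/
theorem tendsto_tsum_primes_rpow_add_log {c : ℝ}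
    (hc : Tendsto (fun x : ℝ => recipSum ⌊x⌋₊ - log (log x)) atTop (𝓝 c)) :
    Tendsto (fun δ : ℝ => ∑' p : Nat.Primes, (p : ℝ) ^ (-(1 + δ)) + log δ) (𝓝[>] 0)
      (𝓝 (c - eulerMascheroniConstant)) := by
  obtain ⟨K, hK⟩ := exists_recipSum_error_bound hc
  let E : ℝ → ℝ → ℝ := fun δ u =>
    (recipSum ⌊exp (u / δ)⌋₊ - log (u / δ) - c) * exp (-u)
  have hmeas : ∀ δ, Measurable (E δ) := fun δ => by
    have h1 : Measurable fun u : ℝ => recipSum ⌊exp (u / δ)⌋₊ :=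
      (measurable_from_nat (f := recipSum)).comp (Nat.measurable_floor.comp (by fun_prop))
    exact ((h1.sub (by fun_prop)).sub_const c).mul (by fun_prop)
  have hbound : Integrable (fun u : ℝ => (K + |log u|) * exp (-u))
      (volume.restrict (Set.Ioi 0)) := by
    have h1 := integrableOn_log_mul_exp_neg.norm
    have h2 := (integrableOn_exp_neg_Ioi 0).const_mul K
    refine (h2.add h1).congr (Eventually.of_forall fun u => ?_)
    simp only [Pi.add_apply, norm_mul, norm_eq_abs, abs_exp]
    ring
  have hle : ∀ δ : ℝ, 0 < δ → δ < 1 → ∀ᵐ u ∂(volume.restrict (Set.Ioi (0 : ℝ))),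
      ‖E δ u‖ ≤ (K + |log u|) * exp (-u) := fun δ h0 h1 => by
    refine (ae_restrict_iff' measurableSet_Ioi).2 (Eventually.of_forall fun u hu => ?_)
    simp only [E, norm_mul, norm_eq_abs, abs_exp]
    exact mul_le_mul_of_nonneg_right (hK δ u h0 h1 hu) (exp_pos _).le
  have hsmall : ∀ᶠ δ : ℝ in 𝓝[>] 0, 0 < δ ∧ δ < 1 := by
    filter_upwards [self_mem_nhdsWithin, mem_nhdsWithin_of_mem_nhds (Iio_mem_nhds one_pos)]
      with δ h0 h1 using ⟨h0, h1⟩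
  have hlim : Tendsto (fun δ => ∫ u in Set.Ioi (0 : ℝ), E δ u) (𝓝[>] 0)
      (𝓝 (∫ u in Set.Ioi (0 : ℝ), (0 : ℝ))) := by
    refine tendsto_integral_filter_of_dominated_convergence _
      (Eventually.of_forall fun δ => (hmeas δ).aestronglyMeasurable)
      (hsmall.mono fun δ h => hle δ h.1 h.2) hbound ?_
    refine (ae_restrict_iff' measurableSet_Ioi).2 (Eventually.of_forall fun u hu => ?_)
    have h1 : Tendsto (fun δ : ℝ => u / δ) (𝓝[>] 0) atTop :=
      tendsto_inv_nhdsGT_zero.const_mul_atTop hu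
    have h2 := ((hc.comp (tendsto_exp_atTop.comp h1)).sub_const c).mul_const (exp (-u))
    rw [sub_self, zero_mul] at h2
    refine h2.congr fun δ => ?_
    simp only [Function.comp_apply, log_exp, E]
  rw [integral_zero] at hlim
  have hfin := hlim.add_const (c - eulerMascheroniConstant)
  rw [zero_add] at hfin
  refine hfin.congr' ?_
  filter_upwards [hsmall] with δ hδ
  have hE : Integrable (E δ) (volume.restrict (Set.Ioi 0)) :=
    hbound.mono' (hmeas δ).aestronglyMeasurable (hle δ hδ.1 hδ.2)
  have hexp : Integrable (fun u : ℝ => (c - log δ) * exp (-u)) (volume.restrict (Set.Ioi 0)) :=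
    (integrableOn_exp_neg_Ioi 0).const_mul _
  have hlogexp : Integrable (fun u : ℝ => log u * exp (-u) + (c - log δ) * exp (-u))
      (volume.restrict (Set.Ioi 0)) := integrableOn_log_mul_exp_neg.add hexp
  have hsplit : ∫ u in Set.Ioi (0 : ℝ), recipSum ⌊exp (u / δ)⌋₊ * exp (-u) =
      ∫ u in Set.Ioi (0 : ℝ), (E δ u + (log u * exp (-u) + (c - log δ) * exp (-u))) := by
    refine setIntegral_congr_fun measurableSet_Ioi fun u hu => ?_
    simp only [E]
    rw [log_div (ne_of_gt hu) hδ.1.ne']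
    ring
  rw [(hasSum_primes_rpow hδ.1).tsum_eq, hsplit,
    integral_add hE hlogexp,
    integral_add integrableOn_log_mul_exp_neg hexp, integral_log_mul_exp_neg, integral_const_mul,
    integral_exp_neg_Ioi_zero]
  ring

end Mertens

/-! ### Mertens' third theorem and the asymptotics of the Euler products. -/

namespace Mertens

open Finset Real Filter Topology

theorem neg_log_one_sub_sub_mem {x : ℝ} (h1 : x ≤ 1 / 2) :
    0 ≤ -log (1 - x) - x ∧ -log (1 - x) - x ≤ 2 * x ^ 2 := by
  have h2 : 0 < 1 - x := by linarith
  have h3 := log_le_sub_one_of_pos h2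
  have h4 := one_sub_inv_le_log_of_pos h2
  have h5 : (1 - x)⁻¹ ≤ 1 + x + 2 * x ^ 2 := by
    rw [inv_le_iff_one_le_mul₀ h2]
    nlinarith [mul_nonneg (sq_nonneg x) (show 0 ≤ 1 - 2 * x by linarith)]
  constructor <;> linarith

theorem rpow_prime_le {δ : ℝ} (hδ : 0 ≤ δ) (p : Nat.Primes) :
    (p : ℝ) ^ (-(1 + δ)) ≤ 1 / p := by
  have hp : (1 : ℝ) < p := by exact_mod_cast p.2.one_lt
  rw [one_div, ← rpow_neg_one]
  exact rpow_le_rpow_of_exponent_le hp.le (by linarith)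

theorem one_div_prime_le (p : Nat.Primes) : (1 : ℝ) / p ≤ 1 / 2 :=
  one_div_le_one_div_of_le two_pos (by exact_mod_cast p.2.two_le)

/-- The term `-log (1 - p ^ (-(1 + δ))) - p ^ (-(1 + δ))`. -/
noncomputable def logRemainder (δ : ℝ) (p : ℕ) : ℝ :=
  -log (1 - (p : ℝ) ^ (-(1 + δ))) - (p : ℝ) ^ (-(1 + δ))

theorem logRemainder_mem {δ : ℝ} (hδ : 0 ≤ δ) (p : Nat.Primes) :
    0 ≤ logRemainder δ p ∧ logRemainder δ p ≤ 2 * ((1 : ℝ) / p) ^ 2 := by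
  have h1 := rpow_prime_le hδ p
  have h2 := neg_log_one_sub_sub_mem (h1.trans (one_div_prime_le p))
  refine ⟨h2.1, h2.2.trans ?_⟩
  gcongr

theorem summable_two_mul_one_div_prime_sq :
    Summable fun p : Nat.Primes => 2 * ((1 : ℝ) / p) ^ 2 := by
  have h : Summable fun n : ℕ => 2 * ((1 : ℝ) / n) ^ 2 := by
    simp only [one_div, inv_pow]
    exact (Real.summable_nat_pow_inv.2 one_lt_two).mul_left 2
  exact h.subtype {n : ℕ | n.Prime}

theorem summable_logRemainder {δ : ℝ} (hδ : 0 ≤ δ) :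
    Summable fun p : Nat.Primes => logRemainder δ p :=
  Summable.of_nonneg_of_le (fun p => (logRemainder_mem hδ p).1)
    (fun p => (logRemainder_mem hδ p).2) summable_two_mul_one_div_prime_sq

theorem tendsto_tsum_logRemainder :
    Tendsto (fun δ : ℝ => ∑' p : Nat.Primes, logRemainder δ p) (𝓝[>] 0)
      (𝓝 (∑' p : Nat.Primes, logRemainder 0 p)) := by
  refine tendsto_tsum_of_dominated_convergence summable_two_mul_one_div_prime_sq (fun p => ?_) ?_
  · have hp : (1 : ℝ) < p := by exact_mod_cast p.2.one_lt
    have h1 : ContinuousAt (fun δ : ℝ => (p : ℝ) ^ (-(1 + δ))) 0 :=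
      ContinuousAt.rpow continuousAt_const (by fun_prop) (Or.inl (by linarith))
    have h2 : (1 : ℝ) - (p : ℝ) ^ (-(1 + 0 : ℝ)) ≠ 0 := by
      have := (rpow_prime_le le_rfl p).trans (one_div_prime_le p)
      exact (sub_pos.2 (this.trans_lt one_half_lt_one)).ne'
    have h3 : ContinuousAt (fun δ : ℝ => logRemainder δ p) 0 :=
      ((continuousAt_const.sub h1).log h2).neg.sub h1
    exact h3.tendsto.mono_left nhdsWithin_le_nhds
  · filter_upwards [self_mem_nhdsWithin] with δ hδ p
    rw [norm_of_nonneg (logRemainder_mem (le_of_lt hδ) p).1]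
    exact (logRemainder_mem (le_of_lt hδ) p).2

theorem exp_tsum_neg_log_eq_riemannZeta {δ : ℝ} (hδ : 0 < δ) :
    ((exp (∑' p : Nat.Primes, -log (1 - (p : ℝ) ^ (-(1 + δ)))) : ℝ) : ℂ) =
      riemannZeta ((1 + δ : ℝ) : ℂ) := by
  rw [← riemannZeta_eulerProduct_exp_log (by simpa using hδ), Complex.ofReal_exp,
    Complex.ofReal_tsum]
  congr 1
  refine tsum_congr fun p => ?_
  have h1 := (rpow_prime_le hδ.le p).trans (one_div_prime_le p)
  rw [Complex.ofReal_neg, Complex.ofReal_log (by linarith), Complex.ofReal_sub,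
    Complex.ofReal_cpow (Nat.cast_nonneg _)]
  simp

/-- The logarithm of `δ ζ(1 + δ) → 1`, the residue of `ζ` at 1. -/
theorem tendsto_tsum_neg_log_add_log :
    Tendsto (fun δ : ℝ => ∑' p : Nat.Primes, -log (1 - (p : ℝ) ^ (-(1 + δ))) + log δ) (𝓝[>] 0)
      (𝓝 0) := by
  have h1 : Tendsto (fun δ : ℝ => ((1 + δ : ℝ) : ℂ)) (𝓝[>] 0) (𝓝[≠] 1) := by
    refine tendsto_nhdsWithin_iff.2 ⟨?_, ?_⟩
    · have : Continuous fun δ : ℝ => ((1 + δ : ℝ) : ℂ) := by fun_prop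
      have h := this.tendsto 0
      simp only [add_zero, Complex.ofReal_one] at h
      exact h.mono_left nhdsWithin_le_nhds
    · filter_upwards [self_mem_nhdsWithin] with δ hδ
      have : δ ≠ 0 := ne_of_gt hδ
      simpa using this
  have h2 : Tendsto (fun δ : ℝ =>
      δ * exp (∑' p : Nat.Primes, -log (1 - (p : ℝ) ^ (-(1 + δ))))) (𝓝[>] 0) (𝓝 1) := by
    rw [← tendsto_ofReal_iff, Complex.ofReal_one]
    refine (riemannZeta_residue_one.comp h1).congr' ?_
    filter_upwards [self_mem_nhdsWithin] with δ hδ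
    rw [Complex.ofReal_mul, exp_tsum_neg_log_eq_riemannZeta hδ]
    simp
  have h3 := h2.log one_ne_zero
  rw [log_one] at h3
  refine h3.congr' ?_
  filter_upwards [self_mem_nhdsWithin] with δ hδ
  rw [log_mul (ne_of_gt hδ) (exp_pos _).ne', log_exp, add_comm]

/-- Here `γ` enters: for `δ > 0` the remainder sum is `log ζ(1 + δ)` minus the prime sum, and the
`log δ` singularities cancel in the limit. -/
theorem tsum_logRemainder_zero {c : ℝ}
    (hc : Tendsto (fun x : ℝ => recipSum ⌊x⌋₊ - log (log x)) atTop (𝓝 c)) :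
    ∑' p : Nat.Primes, logRemainder 0 p = eulerMascheroniConstant - c := by
  have h := tendsto_tsum_neg_log_add_log.sub (tendsto_tsum_primes_rpow_add_log hc)
  refine tendsto_nhds_unique tendsto_tsum_logRemainder ?_
  rw [zero_sub, neg_sub] at h
  refine h.congr' ?_
  filter_upwards [self_mem_nhdsWithin] with δ hδ
  have h1 := (hasSum_primes_rpow hδ).summable
  have h2 := summable_logRemainder (le_of_lt hδ)
  have h3 : ∑' p : Nat.Primes, -log (1 - (p : ℝ) ^ (-(1 + δ))) =
      ∑' p : Nat.Primes, logRemainder δ p + ∑' p : Nat.Primes, (p : ℝ) ^ (-(1 + δ)) := by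
    rw [← h2.tsum_add h1]
    refine tsum_congr fun p => ?_
    simp [logRemainder]
  rw [h3]
  ring

theorem sum_primesLE_eq_sum_range (f : ℕ → ℝ) (N : ℕ) :
    ∑ p ∈ Nat.primesLE N, f p = ∑ n ∈ range (N + 1), if n.Prime then f n else 0 := by
  rw [Nat.primesLE_eq_filter_range, sum_filter]

theorem tendsto_sum_neg_log_sub_log_log :
    Tendsto (fun N : ℕ => ∑ p ∈ Nat.primesLE N, -log (1 - 1 / (p : ℝ)) - log (log N)) atTop
      (𝓝 eulerMascheroniConstant) := by
  obtain ⟨c, hc, hc'⟩ := exists_tendsto_recipSum_floor_sub_log_log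
  have h1 := (summable_logRemainder le_rfl).hasSum
  rw [tsum_logRemainder_zero hc', Nat.Primes.hasSum_iff_hasSum_ite] at h1
  have h2 := (h1.tendsto_sum_nat.comp (tendsto_add_atTop_nat 1)).add hc
  rw [sub_add_cancel] at h2
  refine h2.congr fun N => ?_
  simp only [Function.comp_apply]
  rw [← sum_primesLE_eq_sum_range, recipSum, add_sub_assoc', ← sum_add_distrib]
  congr 1
  refine sum_congr rfl fun p _ => ?_
  simp [logRemainder, rpow_neg_one]

/-- Mertens' third theorem. -/
theorem tendsto_prod_one_sub_inv_div_log :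
    Tendsto (fun N : ℕ => (∏ p ∈ Nat.primesLE N, (1 - 1 / (p : ℝ))⁻¹) / log N) atTop
      (𝓝 (exp eulerMascheroniConstant)) := by
  refine ((continuous_exp.tendsto _).comp tendsto_sum_neg_log_sub_log_log).congr' ?_
  filter_upwards [eventually_ge_atTop 2] with N hN
  have hl : 0 < log (N : ℝ) := log_pos (by exact_mod_cast hN)
  rw [Function.comp_apply, exp_sub, exp_log hl, exp_sum]
  congr 1
  refine prod_congr rfl fun p hp => ?_
  have := one_div_prime_le ⟨p, Nat.prime_of_mem_primesLE hp⟩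
  rw [exp_neg, exp_log]
  simp only at this
  linarith

theorem tendsto_prod_one_sub_pow {m : ℕ} (hm : 2 ≤ m) :
    Tendsto (fun N : ℕ => ∏ p ∈ Nat.primesLE N, (1 - ((p : ℝ) ^ m)⁻¹)) atTop
      (𝓝 (SConv.zetaNat m)⁻¹) := by
  have h1 : 1 < ((m : ℕ) : ℂ).re := by simpa using (by omega : 1 < m)
  have hne : SConv.zetaNat m ≠ 0 := by
    intro h
    have := SConv.ofReal_zetaNat m hm
    rw [h] at this
    exact riemannZeta_ne_zero_of_one_lt_re h1 (by simpa using this.symm)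
  have h2 := (riemannZeta_eulerProduct h1).comp (tendsto_add_atTop_nat 1)
  rw [← SConv.ofReal_zetaNat m hm] at h2
  have h3 : Tendsto (fun N : ℕ => ∏ p ∈ Nat.primesLE N, (1 - ((p : ℝ) ^ m)⁻¹)⁻¹) atTop
      (𝓝 (SConv.zetaNat m)) := by
    rw [← tendsto_ofReal_iff]
    refine h2.congr fun N => ?_
    simp only [Function.comp_apply, Nat.primesLE]
    push_cast
    refine prod_congr rfl fun p _ => ?_
    rw [Complex.cpow_neg, Complex.cpow_natCast]
  refine (h3.inv₀ hne).congr fun N => ?_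
  rw [← prod_inv_distrib]
  simp

/-- `∏_{p ≤ N} (1 - p ^ (-m)) / (1 - 1 / p) ∼ (e ^ γ / ζ(m)) log N`. -/
theorem tendsto_prod_div_log {m : ℕ} (hm : 2 ≤ m) :
    Tendsto (fun N : ℕ =>
      (∏ p ∈ Nat.primesLE N, (1 - ((p : ℝ) ^ m)⁻¹) * (1 - 1 / (p : ℝ))⁻¹) / log N) atTop
      (𝓝 (exp eulerMascheroniConstant / SConv.zetaNat m)) := by
  have h := (tendsto_prod_one_sub_pow hm).mul tendsto_prod_one_sub_inv_div_log
  rw [mul_comm, ← div_eq_mul_inv] at h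
  refine h.congr fun N => ?_
  rw [prod_mul_distrib, mul_div_assoc]

end Mertens

/-! ### Multiplicativity of `σ_S(n) / n` and its values at prime powers. -/

namespace SConv

open Finset

theorem IsMultiplicativeSet.mul_mem_iff {S : Set ℕ} (hS : IsMultiplicativeSet S) {m n : ℕ}
    (hm : 0 < m) (hn : 0 < n) (h : m.Coprime n) : m * n ∈ S ↔ m ∈ S ∧ n ∈ S := by
  have := hS.2 m n hm hn h
  by_cases h1 : m ∈ S <;> by_cases h2 : n ∈ S <;> by_cases h3 : m * n ∈ S <;>
    simp_all [rho]

theorem isMultiplicativeSet_of_mul_mem_iff {S : Set ℕ} (h1 : 1 ∈ S)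
    (h : ∀ m n : ℕ, 0 < m → 0 < n → m.Coprime n → (m * n ∈ S ↔ m ∈ S ∧ n ∈ S)) :
    IsMultiplicativeSet S := by
  refine ⟨h1, fun m n hm hn hmn => ?_⟩
  have := h m n hm hn hmn
  by_cases h1 : m ∈ S <;> by_cases h2 : n ∈ S <;> by_cases h3 : m * n ∈ S <;>
    simp_all [rho]

/-- The gcd splits as a product of coprime factors, one from each side, and `S` is multiplicative.
-/
theorem IsMultiplicativeSet.isSDivisor_mul_iff {S : Set ℕ} (hS : IsMultiplicativeSet S)
    {m n d e : ℕ} (hm : m ≠ 0) (hn : n ≠ 0) (h : m.Coprime n) (hd : d ∣ m) (he : e ∣ n) :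
    IsSDivisor S (d * e) (m * n) ↔ IsSDivisor S d m ∧ IsSDivisor S e n := by
  obtain ⟨d', rfl⟩ := hd
  obtain ⟨e', rfl⟩ := he
  have hd0 : 0 < d := Nat.pos_of_ne_zero (left_ne_zero_of_mul hm)
  have he0 : 0 < e := Nat.pos_of_ne_zero (left_ne_zero_of_mul hn)
  have h1 : d * d' * (e * e') = d * e * (d' * e') := by ring
  have hde : d'.Coprime e' := (h.coprime_mul_left).coprime_mul_left_right
  have hde1 : e.Coprime d' := (h.coprime_mul_left.coprime_mul_right_right).symm
  have hde2 : d.Coprime e' := h.coprime_mul_right.coprime_mul_left_right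
  have hde3 : d.Coprime e := h.coprime_mul_right.coprime_mul_right_right
  have h2 : Nat.gcd (d * e) (d' * e') = Nat.gcd d d' * Nat.gcd e e' := by
    rw [hde.gcd_mul, hde1.gcd_mul_right_cancel, hde2.gcd_mul_left_cancel]
  rw [IsSDivisor, IsSDivisor, IsSDivisor, h1, Nat.mul_div_cancel_left _ (Nat.mul_pos hd0 he0),
    Nat.mul_div_cancel_left _ hd0, Nat.mul_div_cancel_left _ he0, h2,
    hS.mul_mem_iff (Nat.gcd_pos_of_pos_left _ hd0) (Nat.gcd_pos_of_pos_left _ he0)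
      ((hde3.coprime_dvd_left (Nat.gcd_dvd_left _ _)).coprime_dvd_right (Nat.gcd_dvd_left _ _))]
  simp

theorem IsMultiplicativeSet.sigma_mul {S : Set ℕ} (hS : IsMultiplicativeSet S) {m n : ℕ}
    (h : m.Coprime n) : sigma S (m * n) = sigma S m * sigma S n := by
  rcases eq_or_ne m 0 with rfl | hm
  · simp [sigma]
  rcases eq_or_ne n 0 with rfl | hn
  · simp [sigma]
  classical
  simp only [sigma]
  rw [sum_filter, sum_filter, sum_filter, sum_mul_sum, ← sum_product', Nat.divisors_mul,
    Finset.mul_def, sum_image h.mul_injOn_divisors]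
  refine sum_congr rfl fun x hx => ?_
  rw [mem_product, Nat.mem_divisors, Nat.mem_divisors] at hx
  have := hS.isSDivisor_mul_iff hm hn h hx.1.1 hx.2.1
  by_cases h1 : IsSDivisor S x.1 m <;> by_cases h2 : IsSDivisor S x.2 n <;> simp_all

theorem sigma_one {S : Set ℕ} (hS : IsMultiplicativeSet S) : sigma S 1 = 1 := by
  rw [sigma, Nat.divisors_one, sum_filter, sum_singleton, if_pos]
  exact ⟨dvd_rfl, by simpa using hS.1⟩

/-- The arithmetic function `n ↦ σ_S(n) / n`. -/
noncomputable def sigmaRatio (S : Set ℕ) : ArithmeticFunction ℝ :=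
  ⟨fun n => (sigma S n : ℝ) / n, by simp⟩

theorem sigmaRatio_apply (S : Set ℕ) (n : ℕ) : sigmaRatio S n = (sigma S n : ℝ) / n := rfl

theorem isMultiplicative_sigmaRatio {S : Set ℕ} (hS : IsMultiplicativeSet S) :
    (sigmaRatio S).IsMultiplicative := by
  refine ⟨by simp [sigmaRatio_apply, sigma_one hS], fun {m n} h => ?_⟩
  simp only [sigmaRatio_apply, hS.sigma_mul h, Nat.cast_mul]
  exact mul_div_mul_comm _ _ _ _

theorem sigmaRatio_nonneg (S : Set ℕ) (n : ℕ) : 0 ≤ sigmaRatio S n := by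
  rw [sigmaRatio_apply]
  positivity

/-- `(1 - p ^ (-m)) / (1 - 1 / p)`. -/
noncomputable def localFactor (m p : ℕ) : ℝ :=
  (1 - ((p : ℝ) ^ m)⁻¹) * (1 - 1 / (p : ℝ))⁻¹

theorem sum_divisors_prime_pow_div {p : ℕ} (hp : p.Prime) (a : ℕ) :
    ((∑ d ∈ (p ^ a).divisors, d : ℕ) : ℝ) / (p ^ a : ℕ) = localFactor (a + 1) p := by
  have hp1 : (1 : ℝ) < p := by exact_mod_cast hp.one_lt
  rw [Nat.sum_divisors_prime_pow hp, localFactor]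
  push_cast
  rw [geom_sum_eq hp1.ne']
  have h1 : (p : ℝ) - 1 ≠ 0 := by linarith
  have h2 : (p : ℝ) ≠ 0 := by linarith
  have h3 : 1 - 1 / (p : ℝ) = (p - 1) / p := by field_simp
  rw [h3]
  field_simp
  ring

theorem inv_pow_add {p : ℕ} (a b : ℕ) : ((p : ℝ) ^ (a + b))⁻¹ = ((p : ℝ) ^ a)⁻¹ * ((p : ℝ) ^ b)⁻¹ := by
  rw [pow_add, mul_inv]

theorem one_sub_one_div_pos {p : ℕ} (hp : p.Prime) : (0 : ℝ) < 1 - 1 / p := by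
  have hp1 : (1 : ℝ) < p := by exact_mod_cast hp.one_lt
  rw [sub_pos, div_lt_one (by linarith)]
  exact hp1

theorem localFactor_mono {p : ℕ} (hp : p.Prime) {a b : ℕ} (h : a ≤ b) :
    localFactor a p ≤ localFactor b p := by
  have hp1 : (1 : ℝ) ≤ p := by exact_mod_cast hp.one_lt.le
  have h0 := (inv_pos.2 (one_sub_one_div_pos hp)).le
  unfold localFactor
  gcongr

theorem one_le_localFactor {p : ℕ} (hp : p.Prime) {m : ℕ} (hm : 1 ≤ m) : 1 ≤ localFactor m p := by
  refine le_trans ?_ (localFactor_mono hp hm)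
  rw [localFactor, pow_one, ← one_div, mul_inv_cancel₀ (one_sub_one_div_pos hp).ne']

theorem localFactor_le_inv {p : ℕ} (hp : p.Prime) (m : ℕ) :
    localFactor m p ≤ (1 - 1 / (p : ℝ))⁻¹ := by
  refine mul_le_of_le_one_left (inv_pos.2 (one_sub_one_div_pos hp)).le ?_
  have : 0 ≤ ((p : ℝ) ^ m)⁻¹ := by positivity
  linarith

theorem sigma_le_sum_divisors (S : Set ℕ) (n : ℕ) : sigma S n ≤ ∑ d ∈ n.divisors, d := by
  classical
  exact sum_le_sum_of_subset (filter_subset _ _)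

theorem sigma_add_le {S : Set ℕ} {d n : ℕ} (hd : d ∈ n.divisors) (h : ¬ IsSDivisor S d n) :
    sigma S n + d ≤ ∑ e ∈ n.divisors, e := by
  classical
  rw [← sum_erase_add _ _ hd]
  refine Nat.add_le_add_right (sum_le_sum_of_subset fun e he => ?_) d
  rw [mem_filter] at he
  refine mem_erase.2 ⟨?_, he.1⟩
  rintro rfl
  exact h he.2

theorem gcd_prime_pow_pow_sub {p a j : ℕ} (hp : p.Prime) (hj : j ≤ a) :
    Nat.gcd (p ^ j) (p ^ a / p ^ j) = p ^ min j (a - j) := by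
  rw [Nat.pow_div hj hp.pos]
  rcases le_total j (a - j) with h | h
  · rw [min_eq_left h, Nat.gcd_eq_left (pow_dvd_pow p h)]
  · rw [min_eq_right h, Nat.gcd_eq_right (pow_dvd_pow p h)]

theorem sigmaRatio_prime_pow_le {S : Set ℕ} {s : ℕ} (hs : HasUniformExponent S s) {p : ℕ}
    (hp : p.Prime) (a : ℕ) : sigmaRatio S (p ^ a) ≤ localFactor (2 * s) p := by
  have hp0 : (0 : ℝ) < (p ^ a : ℕ) := by exact_mod_cast pow_pos hp.pos a
  rcases lt_or_ge a (2 * s) with h | h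
  · refine le_trans ?_ (localFactor_mono hp (show a + 1 ≤ 2 * s from h))
    rw [← sum_divisors_prime_pow_div hp, sigmaRatio_apply]
    gcongr
    exact sigma_le_sum_divisors S _
  · have hs1 := hs.1
    have hmem : p ^ (a - s) ∈ (p ^ a).divisors :=
      Nat.mem_divisors.2 ⟨pow_dvd_pow p (by omega), (pow_pos hp.pos a).ne'⟩
    have hnot : ¬ IsSDivisor S (p ^ (a - s)) (p ^ a) := by
      rintro ⟨-, h2⟩
      rw [gcd_prime_pow_pow_sub hp (by omega), show min (a - s) (a - (a - s)) = s by omega] at h2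
      exact (hs.2 p hp).2 h2
    have h1 : (sigma S (p ^ a) : ℝ) + (p : ℝ) ^ (a - s) ≤
        ((∑ d ∈ (p ^ a).divisors, d : ℕ) : ℝ) := by
      exact_mod_cast sigma_add_le hmem hnot
    have h2 : sigmaRatio S (p ^ a) + ((p : ℝ) ^ s)⁻¹ ≤ localFactor (a + 1) p := by
      rw [← sum_divisors_prime_pow_div hp, sigmaRatio_apply]
      refine le_trans (le_of_eq ?_) (div_le_div_of_nonneg_right h1 hp0.le)
      have hpr : (p : ℝ) ≠ 0 := by exact_mod_cast hp.ne_zero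
      rw [add_div, Nat.cast_pow]
      congr 1
      rw [inv_eq_one_div, div_eq_div_iff (by positivity) (by positivity), one_mul, ← pow_add]
      congr 1
      omega
    have h3 := localFactor_le_inv hp (a + 1)
    have hx0 := one_sub_one_div_pos hp
    -- `p^(-s) ≤ 1/p ≤ 1/2 ≤ 1 - 1/p`. Hence the lost term `p^(-s)` is at least `p^(-2s) / (1 -
    -- 1/p)`, the gap between `1 / (1 - 1/p)` and the claimed bound.
    have hxs : ((p : ℝ) ^ s)⁻¹ ≤ 1 - 1 / p := by
      have hp2 : (2 : ℝ) ≤ p := by exact_mod_cast hp.two_le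
      have h5 : ((p : ℝ) ^ s)⁻¹ ≤ ((p : ℝ) ^ 1)⁻¹ :=
        inv_anti₀ (by positivity) (pow_le_pow_right₀ (by linarith) hs1)
      rw [pow_one] at h5
      have h6 : (p : ℝ)⁻¹ ≤ 2⁻¹ := inv_anti₀ two_pos hp2
      rw [one_div]
      linarith
    have h4 : ((p : ℝ) ^ (2 * s))⁻¹ * (1 - 1 / (p : ℝ))⁻¹ ≤ ((p : ℝ) ^ s)⁻¹ := by
      rw [two_mul, inv_pow_add, mul_assoc]
      refine mul_le_of_le_one_right (by positivity) ?_
      rw [← div_eq_mul_inv, div_le_one hx0]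
      exact hxs
    have h5 : localFactor (2 * s) p =
        (1 - 1 / (p : ℝ))⁻¹ - ((p : ℝ) ^ (2 * s))⁻¹ * (1 - 1 / (p : ℝ))⁻¹ := by
      rw [localFactor]
      ring
    linarith

theorem sigmaRatio_prime_pow_eq {S : Set ℕ} (h1 : 1 ∈ S) {s : ℕ} (hs : HasUniformExponent S s)
    {p : ℕ} (hp : p.Prime) : sigmaRatio S (p ^ (2 * s - 1)) = localFactor (2 * s) p := by
  classical
  have hs1 := hs.1
  rw [show 2 * s = 2 * s - 1 + 1 by omega, ← sum_divisors_prime_pow_div hp, sigmaRatio_apply,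
    Nat.add_sub_cancel]
  rw [sigma, filter_true_of_mem fun d hd => ?_]
  obtain ⟨j, hj, rfl⟩ := (Nat.mem_divisors_prime_pow hp _).1 hd
  refine ⟨pow_dvd_pow p hj, ?_⟩
  rw [gcd_prime_pow_pow_sub hp hj]
  rcases Nat.eq_zero_or_pos (min j (2 * s - 1 - j)) with h | h
  · rw [h, pow_zero]
    exact h1
  · exact (hs.2 p hp).1 _ h (by omega)

/-! ### The `k`-free and `k`-full integers. -/

theorem isMultiplicativeSet_kFree {k : ℕ} (hk : 1 ≤ k) : IsMultiplicativeSet (kFree k) := by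
  have hiff : ∀ n, n ∈ kFree k ↔ 0 < n ∧ ∀ p : ℕ, p.Prime → ¬ p ^ k ∣ n := fun n =>
    and_congr_right fun _ => forall₂_congr fun p _ =>
      ⟨fun h hd => h ((dvd_pow_self p (by omega)).trans hd) hd, fun h _ => h⟩
  refine isMultiplicativeSet_of_mul_mem_iff ?_ fun m n hm hn hmn => ?_
  · refine (hiff 1).2 ⟨one_pos, fun p hp h => ?_⟩
    exact hp.one_lt.ne' (Nat.dvd_one.1 ((dvd_pow_self p (by omega)).trans h))
  · have h : ∀ p : ℕ, p.Prime → (p ^ k ∣ m * n ↔ p ^ k ∣ m ∨ p ^ k ∣ n) := fun p hp =>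
      Nat.Coprime.isPrimePow_dvd_mul hmn (hp.isPrimePow.pow (by omega))
    simp only [hiff, hm, hn, Nat.mul_pos hm hn, true_and]
    constructor
    · exact fun H => ⟨fun p hp h1 => H p hp ((h p hp).2 (Or.inl h1)),
        fun p hp h1 => H p hp ((h p hp).2 (Or.inr h1))⟩
    · rintro ⟨H1, H2⟩ p hp h1
      exact ((h p hp).1 h1).elim (H1 p hp) (H2 p hp)

theorem hasUniformExponent_kFree {k : ℕ} (hk : 1 ≤ k) : HasUniformExponent (kFree k) k := by
  refine ⟨hk, fun p hp => ⟨fun j _ hj => ⟨pow_pos hp.pos j, fun q hq hqp hqk => ?_⟩, fun h => ?_⟩⟩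
  · rw [(Nat.prime_dvd_prime_iff_eq hq hp).1 (hq.dvd_of_dvd_pow hqp),
      Nat.pow_dvd_pow_iff_le_right hp.one_lt] at hqk
    omega
  · exact h.2 p hp (dvd_pow_self p (by omega)) dvd_rfl

theorem isMultiplicativeSet_kFull (k : ℕ) : IsMultiplicativeSet (kFull k) := by
  refine isMultiplicativeSet_of_mul_mem_iff ?_ fun m n hm hn hmn => ?_
  · exact ⟨one_pos, fun p hp h => absurd (Nat.dvd_one.1 h) hp.one_lt.ne'⟩
  · have key : ∀ {m n : ℕ}, m.Coprime n → ∀ p : ℕ, p.Prime → p ∣ m → p ^ k ∣ m * n → p ^ k ∣ m :=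
      fun hmn p hp hpm h => (Nat.Coprime.pow_left k (hmn.coprime_dvd_left hpm)).dvd_of_dvd_mul_right h
    constructor
    · rintro ⟨-, H⟩
      refine ⟨⟨hm, fun p hp h => key hmn p hp h (H p hp (h.mul_right n))⟩,
        ⟨hn, fun p hp h => key hmn.symm p hp h ?_⟩⟩
      rw [mul_comm]
      exact H p hp (h.mul_left m)
    · rintro ⟨⟨-, H1⟩, ⟨-, H2⟩⟩
      refine ⟨Nat.mul_pos hm hn, fun p hp h => ?_⟩
      exact (hp.dvd_mul.1 h).elim (fun h => (H1 p hp h).mul_right n)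
        fun h => (H2 p hp h).mul_left m

theorem hasUniformExponent_kFull {k : ℕ} (hk : 2 ≤ k) : HasUniformExponent (kFull k) 1 := by
  refine ⟨le_rfl, fun p hp => ⟨fun j h1 h2 => by omega, fun h => ?_⟩⟩
  have := h.2 p hp (dvd_pow_self p one_ne_zero)
  rw [Nat.pow_dvd_pow_iff_le_right hp.one_lt] at this
  omega

end SConv

/-! ### The upper limit: both inequalities. -/

namespace SConv

open Finset Filter Topology Real

/-- `∏_{p ≤ N} (1 - p ^ (-m)) / (1 - 1 / p)`. -/
noncomputable def localProd (m N : ℕ) : ℝ := ∏ p ∈ Nat.primesLE N, localFactor m p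

theorem tendsto_localProd_div_log {m : ℕ} (hm : 2 ≤ m) :
    Tendsto (fun N : ℕ => localProd m N / log N) atTop
      (𝓝 (exp eulerMascheroniConstant / zetaNat m)) :=
  Mertens.tendsto_prod_div_log hm

theorem one_le_localProd {m : ℕ} (hm : 1 ≤ m) (N : ℕ) : 1 ≤ localProd m N :=
  one_le_prod fun _ hp => one_le_localFactor (Nat.prime_of_mem_primesLE hp) hm

theorem sigmaRatio_le_prod_primeFactors {S : Set ℕ} (hS : IsMultiplicativeSet S) {s : ℕ}
    (hs : HasUniformExponent S s) {n : ℕ} (hn : n ≠ 0) :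
    sigmaRatio S n ≤ ∏ p ∈ n.primeFactors, localFactor (2 * s) p := by
  rw [(isMultiplicative_sigmaRatio hS).multiplicative_factorization _ hn]
  exact prod_le_prod (fun p _ => sigmaRatio_nonneg S _)
    fun p hp => sigmaRatio_prime_pow_le hs (Nat.prime_of_mem_primeFactors hp) _

/-- The product of these primes divides `n`, and each of them exceeds `y`. -/
theorem card_large_primeFactors_mul_log_le {n : ℕ} (hn : n ≠ 0) {y : ℝ} (hy : 1 < y) :
    (#{p ∈ n.primeFactors | ¬ p ≤ ⌊y⌋₊} : ℝ) * log y ≤ log n := by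
  rw [← log_pow]
  refine log_le_log (by positivity) ?_
  have h1 : y ^ #{p ∈ n.primeFactors | ¬ p ≤ ⌊y⌋₊} ≤
      ∏ p ∈ n.primeFactors with ¬ p ≤ ⌊y⌋₊, (p : ℝ) := by
    rw [← prod_const]
    refine prod_le_prod (fun _ _ => by linarith) fun p hp => ?_
    rw [mem_filter, not_le, Nat.floor_lt (by linarith)] at hp
    exact hp.2.le
  have h2 : ∏ p ∈ n.primeFactors with ¬ p ≤ ⌊y⌋₊, p ≤ n :=
    Nat.le_of_dvd (Nat.pos_of_ne_zero hn)
      ((prod_dvd_prod_of_subset _ _ _ (filter_subset _ _)).trans (Nat.prod_primeFactors_dvd n))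
  refine h1.trans ?_
  rw [← Nat.cast_prod]
  exact Nat.cast_le.2 h2

theorem localFactor_le_exp {m p : ℕ} (hp : p.Prime) {y : ℝ} (hy : 1 < y) (hpy : y ≤ p) :
    localFactor m p ≤ exp (1 / (y - 1)) := by
  have hp1 : (1 : ℝ) < p := by linarith
  have h1 : (1 - 1 / (p : ℝ))⁻¹ = 1 / (p - 1 : ℝ) + 1 := by
    have : (p : ℝ) - 1 ≠ 0 := by linarith
    rw [show 1 - 1 / (p : ℝ) = (p - 1) / p by field_simp]
    field_simp
    ring
  have h2 : 1 / (p - 1 : ℝ) ≤ 1 / (y - 1) :=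
    one_div_le_one_div_of_le (by linarith) (by linarith)
  refine (localFactor_le_inv hp m).trans ?_
  rw [h1]
  exact (add_le_add_left h2 1).trans (add_one_le_exp _)

theorem sigmaRatio_le {S : Set ℕ} (hS : IsMultiplicativeSet S) {s : ℕ}
    (hs : HasUniformExponent S s) {n : ℕ} (hn : n ≠ 0) (hy : 2 ≤ log (n : ℝ)) :
    sigmaRatio S n ≤ localProd (2 * s) ⌊log (n : ℝ)⌋₊ * exp (2 / log (log n)) := by
  have hs1 := hs.1
  have hk := card_large_primeFactors_mul_log_le hn (y := log n) (by linarith)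
  set y := log (n : ℝ)
  have hly : 0 < log y := log_pos (by linarith)
  refine (sigmaRatio_le_prod_primeFactors hS hs hn).trans ?_
  rw [← prod_filter_mul_prod_filter_not n.primeFactors (fun p => p ≤ ⌊y⌋₊)]
  refine mul_le_mul ?_ ?_ (prod_nonneg fun p hp => ?_)
    (zero_le_one.trans (one_le_localProd (by omega) _))
  · refine prod_le_prod_of_subset_of_one_le (fun p hp => ?_) (fun p hp => ?_) fun p hp _ => ?_
    · rw [mem_filter] at hp
      exact Nat.mem_primesLE.2 ⟨hp.2, Nat.prime_of_mem_primeFactors hp.1⟩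
    · exact zero_le_one.trans (one_le_localFactor
        (Nat.prime_of_mem_primeFactors (mem_filter.1 hp).1) (by omega))
    · exact one_le_localFactor (Nat.prime_of_mem_primesLE hp) (by omega)
  · have h1 : ∏ p ∈ n.primeFactors with ¬ p ≤ ⌊y⌋₊, localFactor (2 * s) p ≤
        ∏ p ∈ n.primeFactors with ¬ p ≤ ⌊y⌋₊, exp (1 / (y - 1)) := by
      refine prod_le_prod (fun p hp => ?_) fun p hp => ?_
      · exact zero_le_one.trans (one_le_localFactor
          (Nat.prime_of_mem_primeFactors (mem_filter.1 hp).1) (by omega))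
      · rw [mem_filter, not_le, Nat.floor_lt (by linarith)] at hp
        exact localFactor_le_exp (Nat.prime_of_mem_primeFactors hp.1) (by linarith) hp.2.le
    refine h1.trans ?_
    rw [prod_const, ← exp_nat_mul, exp_le_exp]
    generalize (#{p ∈ n.primeFactors | ¬ p ≤ ⌊y⌋₊} : ℝ) = k at *
    -- With `k log y ≤ y` and `y ≥ 2`, `k log y ≤ 2 (y - 1)`.
    rw [mul_one_div, div_le_div_iff₀ (by linarith) hly]
    linarith
  · exact zero_le_one.trans (one_le_localFactor
      (Nat.prime_of_mem_primeFactors (mem_filter.1 hp).1) (by omega))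

theorem limsupSigma_le {S : Set ℕ} (hS : IsMultiplicativeSet S) {s : ℕ}
    (hs : HasUniformExponent S s) :
    limsupSigma S ≤ ((exp eulerMascheroniConstant / zetaNat (2 * s) : ℝ) : EReal) := by
  have hs1 := hs.1
  have hlog : Tendsto (fun n : ℕ => log (n : ℝ)) atTop atTop :=
    tendsto_log_atTop.comp tendsto_natCast_atTop_atTop
  have hT : Tendsto (fun n : ℕ => localProd (2 * s) ⌊log (n : ℝ)⌋₊ / log (⌊log (n : ℝ)⌋₊ : ℝ) *
      exp (2 / log (log n))) atTop (𝓝 (exp eulerMascheroniConstant / zetaNat (2 * s))) := by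
    have h1 := (tendsto_localProd_div_log (m := 2 * s) (by omega)).comp
      ((tendsto_nat_floor_atTop (α := ℝ)).comp hlog)
    have h2 := (continuous_exp.tendsto 0).comp
      ((tendsto_log_atTop.comp hlog).const_div_atTop (2 : ℝ))
    have h3 := h1.mul h2
    rw [exp_zero, mul_one] at h3
    exact h3
  have hE := (continuous_coe_real_ereal.tendsto _).comp hT
  rw [← hE.limsup_eq]
  refine limsup_le_limsup ?_
  filter_upwards [hlog.eventually_ge_atTop 2, eventually_ne_atTop 0] with n hn hn0
  rw [Function.comp_apply, EReal.coe_le_coe_iff, ← div_div, ← sigmaRatio_apply]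
  set y := log (n : ℝ) with hy
  have hf : (2 : ℝ) ≤ ⌊y⌋₊ := by exact_mod_cast Nat.le_floor (by exact_mod_cast hn)
  have hf' : log (⌊y⌋₊ : ℝ) ≤ log y :=
    log_le_log (by linarith) (Nat.floor_le (by linarith))
  have hf0 : 0 < log (⌊y⌋₊ : ℝ) := log_pos (by linarith)
  have hM := one_le_localProd (m := 2 * s) (by omega) ⌊y⌋₊
  calc sigmaRatio S n / log y ≤ localProd (2 * s) ⌊y⌋₊ * exp (2 / log y) / log y :=
        div_le_div_of_nonneg_right (sigmaRatio_le hS hs hn0 hn) (by linarith)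
    _ ≤ localProd (2 * s) ⌊y⌋₊ * exp (2 / log y) / log ⌊y⌋₊ := by gcongr
    _ = _ := by ring

theorem sigmaRatio_primorial_pow {S : Set ℕ} (hS : IsMultiplicativeSet S) {s : ℕ}
    (hs : HasUniformExponent S s) (N : ℕ) :
    sigmaRatio S (∏ p ∈ Nat.primesLE N, p ^ (2 * s - 1)) = localProd (2 * s) N := by
  rw [(isMultiplicative_sigmaRatio hS).map_prod _ _ fun p hp q hq hpq => ?_]
  · exact prod_congr rfl fun p hp =>
      sigmaRatio_prime_pow_eq hS.1 hs (Nat.prime_of_mem_primesLE hp)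
  · exact Nat.Coprime.pow _ _ ((Nat.coprime_primes (Nat.prime_of_mem_primesLE hp)
      (Nat.prime_of_mem_primesLE hq)).2 hpq)

theorem log_primorial_pow_le (k N : ℕ) :
    log ((∏ p ∈ Nat.primesLE N, p ^ k : ℕ) : ℝ) ≤ k * log 4 * N := by
  rw [prod_pow, Nat.cast_pow, log_pow, Nat.cast_prod, log_prod fun p hp => ?_, mul_assoc]
  · exact mul_le_mul_of_nonneg_left (Mertens.sum_log_primesLE_le N) (Nat.cast_nonneg k)
  · exact_mod_cast (Nat.prime_of_mem_primesLE hp).ne_zero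

theorem tendsto_primorial_pow {k : ℕ} (hk : 1 ≤ k) :
    Tendsto (fun N => ∏ p ∈ Nat.primesLE N, p ^ k) atTop atTop := by
  refine tendsto_atTop_atTop_of_monotone (fun M N h => ?_) fun b => ?_
  · exact prod_le_prod_of_subset_of_one_le' (Nat.primesLE_mono h)
      fun p hp _ => Nat.one_le_pow _ _ (Nat.prime_of_mem_primesLE hp).pos
  · obtain ⟨p, hbp, hp⟩ := Nat.exists_infinite_primes b
    refine ⟨p, hbp.trans ((Nat.le_self_pow (n := k) (by omega) p).trans ?_)⟩
    exact Nat.le_of_dvd (prod_pos fun q hq => pow_pos (Nat.prime_of_mem_primesLE hq).pos _)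
      (dvd_prod_of_mem (fun p => p ^ k) (Nat.mem_primesLE.2 ⟨le_rfl, hp⟩))

theorem le_limsupSigma {S : Set ℕ} (hS : IsMultiplicativeSet S) {s : ℕ}
    (hs : HasUniformExponent S s) :
    ((exp eulerMascheroniConstant / zetaNat (2 * s) : ℝ) : EReal) ≤ limsupSigma S := by
  have hs1 := hs.1
  set k := 2 * s - 1
  have hk : 1 ≤ k := by omega
  have hc : 0 < (k : ℝ) * log 4 :=
    mul_pos (by exact_mod_cast hk) (log_pos (by norm_num))
  set C := (k : ℝ) * log 4
  have hlog : Tendsto (fun n : ℕ => log (n : ℝ)) atTop atTop :=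
    tendsto_log_atTop.comp tendsto_natCast_atTop_atTop
  have hT : Tendsto (fun N : ℕ => localProd (2 * s) N / (log C + log N)) atTop
      (𝓝 (exp eulerMascheroniConstant / zetaNat (2 * s))) := by
    have h1 := tendsto_localProd_div_log (m := 2 * s) (by omega)
    have h2 := (hlog.const_div_atTop (log C)).add_const 1
    rw [zero_add] at h2
    have h3 := h1.div h2 one_ne_zero
    rw [div_one] at h3
    refine h3.congr' ?_
    filter_upwards [hlog.eventually_gt_atTop 0] with N hN
    rw [Pi.div_apply, div_div, mul_add, mul_one, mul_div_cancel₀ _ hN.ne']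
  have hE := (continuous_coe_real_ereal.tendsto _).comp hT
  have hn := tendsto_primorial_pow hk
  rw [← hE.limsup_eq]
  -- An upper limit along the subsequence of products bounds the full one from below.
  refine le_trans ?_ (limsup_le_limsup_of_le hn)
  rw [← Filter.limsup_comp]
  refine limsup_le_limsup ?_
  filter_upwards [(hlog.comp hn).eventually_gt_atTop 1, eventually_gt_atTop 0] with N h1 h2
  rw [Function.comp_apply, Function.comp_apply, EReal.coe_le_coe_iff, ← div_div,
    ← sigmaRatio_apply, sigmaRatio_primorial_pow hS hs]
  simp only [Function.comp_apply] at h1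
  have h3 := log_primorial_pow_le k N
  have hN : (0 : ℝ) < N := by exact_mod_cast h2
  rw [← log_mul hc.ne' hN.ne']
  have hM := one_le_localProd (m := 2 * s) (by omega) N
  have h4 := log_le_log (by linarith) h3
  have h5 := log_pos h1
  exact div_le_div_of_nonneg_left (by linarith) h5 h4

theorem limsupSigma_eq {S : Set ℕ} (hS : IsMultiplicativeSet S) {s : ℕ}
    (hs : HasUniformExponent S s) :
    limsupSigma S = ((exp eulerMascheroniConstant / zetaNat (2 * s) : ℝ) : EReal) :=
  le_antisymm (limsupSigma_le hS hs) (le_limsupSigma hS hs)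

end SConv

theorem theorem5p2 :
    (∀ (S : Set ℕ) (s : ℕ), SConv.IsMultiplicativeSet S → SConv.HasUniformExponent S s →
      SConv.limsupSigma S =
        ((Real.exp Real.eulerMascheroniConstant / SConv.zetaNat (2 * s) : ℝ) : EReal)) ∧
    (∀ k : ℕ, 1 ≤ k →
      SConv.IsMultiplicativeSet (SConv.kFree k) ∧ SConv.HasUniformExponent (SConv.kFree k) k ∧
      SConv.limsupSigma (SConv.kFree k) =
        ((Real.exp Real.eulerMascheroniConstant / SConv.zetaNat (2 * k) : ℝ) : EReal)) ∧
    (∀ k : ℕ, 2 ≤ k →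
      SConv.IsMultiplicativeSet (SConv.kFull k) ∧ SConv.HasUniformExponent (SConv.kFull k) 1 ∧
      SConv.limsupSigma (SConv.kFull k) =
        ((Real.exp Real.eulerMascheroniConstant / SConv.zetaNat 2 : ℝ) : EReal)) :=
  ⟨fun _ _ hS hs => SConv.limsupSigma_eq hS hs,
    fun _ hk => ⟨SConv.isMultiplicativeSet_kFree hk, SConv.hasUniformExponent_kFree hk,
      SConv.limsupSigma_eq (SConv.isMultiplicativeSet_kFree hk)
        (SConv.hasUniformExponent_kFree hk)⟩,
    fun k hk => ⟨SConv.isMultiplicativeSet_kFull k, SConv.hasUniformExponent_kFull hk,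
      SConv.limsupSigma_eq (SConv.isMultiplicativeSet_kFull k)
        (SConv.hasUniformExponent_kFull hk)⟩⟩
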